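/- Let $m\ge 3$ and $\ell\ge 1$ be integers and let $F:\mathrm{GF}(2^{2m})\to \mathrm{GF}(2^{\ell})$ be a bent vectorial function, that is, $$\sum_{x\in \mathrm{GF}(2^{2m})}(-1)^{\mathrm{Tr}_{2^\ell/2}(aF(x))+\mathrm{Tr}_{2^{2m}/2}(bx)}\in\{2^m,-2^m\}$$ for all $a\in \mathrm{GF}(2^\ell)\setminus\{0\}$ and all $b\in \mathrm{GF}(2^{2m})$, where $\mathrm{Tr}_{2^r/2}$ denotes the absolute trace from $\mathrm{GF}(2^r)$ to $\mathrm{GF}(2)$. Let $$\mathcal C(F)=\left\{\left(\mathrm{Tr}_{2^\ell/2}(aF(x))+\mathrm{Tr}_{2^{2m}/2}(bx)+c\right)_{x\in \mathrm{GF}(2^{2m})} : a\in \mathrm{GF}(2^\ell),\ b\in \mathrm{GF}(2^{2m}),\ c\in \mathrm{GF}(2)\right\},$$ a binary linear code with coordinates indexed by $\mathrm{GF}(2^{2m})$. Let $t_1\neq t_2$ be two coordinate positions and let $\mathcal C(F)^{\{t_1,t_2\}}$ be the code obtained from $\mathcal C(F)$ by puncturing on $\{t_1,t_2\}$, i.e.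 by deleting these two coordinates from every codeword. Then $\mathcal C(F)^{\{t_1,t_2\}}$ is a binary linear code of length $2^{2m}-2$ and dimension $2m+\ell+1$, and its weight distribution is as follows (there are no codewords of any other weight): $$\begin{array}{c|c} \text{Weight} & \text{Multiplicity}\\ \hline 0 & 1\\ 2^{2m-1}-2^{m-1}-2 & 2^{m-2}(2^{\ell}-1)(2^{m}-2)\\ 2^{2m-1}-2^{m-1}-1 & 2^{2m-1}(2^{\ell}-1)\\ 2^{2m-1}-2^{m-1} & (2^{\ell}-1)2^{m-2}(2^{m}+2)\\ 2^{2m-1}-2 & 2^{2m-1}-1\\ 2^{2m-1}-1 & 2^{2m}\\ 2^{2m-1} & 2^{2m-1}-1\\ 2^{2m-1}+2^{m-1}-2 & 2^{m-2}(2^{\ell}-1)(2^{m}+2)\\ 2^{2m-1}+2^{m-1}-1 & 2^{2m-1}(2^{\ell}-1)\\ 2^{2m-1}+2^{m-1} & (2^{\ell}-1)2^{m-2}(2^{m}-2)\\ 2^{2m}-2 & 1 \end{array}$$ -/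

import Mathlib

namespace PuncturedBentCode

/-- The number `A_k(C)` of codewords of Hamming weight `k` in a linear code `C ⊆ 𝔽^ι`. -/
noncomputable def weightCount {𝔽 ι : Type*} [Field 𝔽] [DecidableEq 𝔽] [Fintype ι]
    (C : Submodule 𝔽 (ι → 𝔽)) (k : ℕ) : ℕ :=
  Set.ncard {c : ι → 𝔽 | c ∈ C ∧ hammingNorm c = k}

/-- The code obtained from `C ⊆ 𝔽^ι` by puncturing on the set `T` of coordinate positions:
every codeword is restricted to the positions outside `T`. -/
def puncture {𝔽 ι : Type*} [Field 𝔽] (C : Submodule 𝔽 (ι → 𝔽)) (T : Finset ι) :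
    Submodule 𝔽 ({x : ι // x ∉ T} → 𝔽) :=
  C.map (LinearMap.funLeft 𝔽 𝔽 (Subtype.val : {x : ι // x ∉ T} → ι))

variable {K L : Type*} [Field K] [Algebra (ZMod 2) K] [Field L] [Algebra (ZMod 2) L]

/-- The Walsh transform `W_F(a, b) = ∑ x, (-1)^(Tr (a F(x)) + Tr (b x))` of a function `F`
between finite fields of characteristic two, where `Tr` is the absolute trace (of `L` and of
`K`, respectively). -/
noncomputable def walsh [Fintype K] (F : K → L) (a : L) (b : K) : ℤ :=
  ∑ x : K, (-1) ^ (Algebra.trace (ZMod 2) L (a * F x) + Algebra.trace (ZMod 2) K (b * x)).val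

/-- `F : GF(2^n) → GF(2^ℓ)` is a bent vectorial function: each component function
`Tr (a F(x))` with `a ≠ 0` is bent, i.e. has all its Walsh coefficients equal to `± 2^(n/2)`. -/
def IsBentVectorial [Fintype K] (F : K → L) : Prop :=
  ∀ a : L, a ≠ 0 → ∀ b : K,
    (walsh F a b : ℝ) = (2 : ℝ) ^ ((Module.finrank (ZMod 2) K : ℝ) / 2) ∨
    (walsh F a b : ℝ) = -(2 : ℝ) ^ ((Module.finrank (ZMod 2) K : ℝ) / 2)

/-- The binary code `C(F)`, with coordinates indexed by `K`, consisting of the words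
`(Tr (a F(x)) + Tr (b x) + c)_{x ∈ K}` for `a ∈ L`, `b ∈ K`, `c ∈ GF(2)`. -/
def code (F : K → L) : Submodule (ZMod 2) (K → ZMod 2) where
  carrier := {w | ∃ (a : L) (b : K) (c : ZMod 2), w = fun x =>
    Algebra.trace (ZMod 2) L (a * F x) + Algebra.trace (ZMod 2) K (b * x) + c}
  zero_mem' := ⟨0, 0, 0, by ext x; simp⟩
  add_mem' := by
    rintro _ _ ⟨a, b, c, rfl⟩ ⟨a', b', c', rfl⟩
    refine ⟨a + a', b + b', c + c', ?_⟩
    ext x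
    simp only [Pi.add_apply, add_mul, map_add]
    ring
  smul_mem' := by
    rintro r _ ⟨a, b, c, rfl⟩
    refine ⟨r • a, r • b, r * c, ?_⟩
    ext x
    simp only [Pi.smul_apply, smul_eq_mul, smul_mul_assoc, map_smul]
    ring

end PuncturedBentCode

namespace PuncturedBentCode

open Finset

/-! Fix `a` and let q = (b, c) vary. Twice the weight of the punctured word is |K| - 2 - T + s + s',
where T is the sign sum of the full word and s, s' are its signs at the two deleted positions. If a
≠ 0, bentness forces T = ±2^m, so three signs determine the weight, and the indicator of each weight
is a polynomial in them. Counting therefore needs only the moments in `SignMoments`, which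
`signMoments_word` shows to be independent of `a` and `F`: terms odd in the sign of c cancel, and
orthogonality of the characters x ↦ (-1)^Tr(bx) gives the rest. If a = 0, then T = 0 unless b = 0,
and b = 0 gives only the zero word and the all-one word; the same method works after correcting for
these two. Since distinct parameters give distinct punctured words, each multiplicity is a count for
a = 0 plus 2^ℓ - 1 equal counts for a ≠ 0. -/

/-- The sign `(-1)^z` of a bit `z`. -/
def sgn (z : ZMod 2) : ℤ := (-1) ^ z.val

theorem sgn_zero : sgn 0 = 1 := by decide

theorem sgn_one : sgn 1 = -1 := by decide

theorem sgn_add (y z : ZMod 2) : sgn (y + z) = sgn y * sgn z := by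
  revert y z; decide

theorem sgn_mul_self (z : ZMod 2) : sgn z * sgn z = 1 := by
  revert z; decide

theorem sgn_eq_or (z : ZMod 2) : sgn z = 1 ∨ sgn z = -1 := by
  revert z; decide

theorem sgn_eq_ite (z : ZMod 2) : sgn z = 1 - 2 * if z ≠ 0 then 1 else 0 := by
  revert z; decide

theorem sum_sgn : ∑ c : ZMod 2, sgn c = 0 := by decide

theorem sum_mul_sgn_eq_zero {B : Type*} [Fintype B] (g : B → ℤ) {f : B × ZMod 2 → ℤ}
    (h : ∀ b c, f (b, c) = g b * sgn c) : ∑ q, f q = 0 := by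
  simp [Fintype.sum_prod_type, h, ← mul_sum, sum_sgn]

theorem sum_sgn_eq_card_sub {ι : Type*} [Fintype ι] (w : ι → ZMod 2) :
    ∑ i, sgn (w i) = Fintype.card ι - 2 * (hammingNorm w : ℤ) := by
  simp only [sgn_eq_ite, sum_sub_distrib, ← mul_sum, sum_boole]
  simp [hammingNorm]

/-- The factor `D` clears the denominators of an indicator polynomial, so that counting stays in ℤ.
-/
theorem card_filter_mul_eq_sum {B : Type*} [Fintype B] (p : B → Prop) [DecidablePred p]
    (D : ℤ) (g : B → ℤ) (h : ∀ b, (if p b then D else 0) = g b) :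
    D * (#{b | p b} : ℤ) = ∑ b, g b := by
  simp only [← h, ← sum_filter, sum_const, nsmul_eq_mul]
  ring

/-! ### Counting sign patterns from moments -/

/-- The moments of the normalised sign sums `T`, `s`, `s'` that determine weight counts. -/
structure SignMoments {B : Type*} [Fintype B] (T s s' : B → ℤ) (N R : ℤ) : Prop where
  card : (Fintype.card B : ℤ) = N
  left : ∑ b, s b = 0
  right : ∑ b, s' b = 0
  both : ∑ b, s b * s' b = 0
  total : ∑ b, T b = 0
  total_left : ∑ b, T b * s b = R
  total_right : ∑ b, T b * s' b = R
  total_both : ∑ b, T b * (s b * s' b) = 0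

section Counting

variable {B : Type*} [Fintype B] {T s s' : B → ℤ} {wt : B → ℕ} {M N R : ℤ}

theorem SignMoments.sum_eq (h : SignMoments T s s' N R) (c₀ c₁ c₂ c₃ c₄ c₅ : ℤ) :
    ∑ b, (c₀ + c₁ * s b + c₁ * s' b + c₂ * (s b * s' b) + c₃ * T b + c₄ * (T b * s b)
      + c₄ * (T b * s' b) + c₅ * (T b * (s b * s' b))) = c₀ * N + 2 * c₄ * R := by
  simp only [sum_add_distrib, ← mul_sum, h.left, h.right, h.both, h.total, h.total_left,
    h.total_right, h.total_both, sum_const, card_univ, nsmul_eq_mul, h.card]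
  ring

theorem SignMoments.card_bent_equal (h : SignMoments T s s' (2 * M ^ 2) (2 * M ^ 2))
    (hM : 8 ≤ M) (hT : ∀ b, T b = M ∨ T b = -M) (hs : ∀ b, s b = 1 ∨ s b = -1)
    (hs' : ∀ b, s' b = 1 ∨ s' b = -1)
    (hwt : ∀ b, 2 * (wt b : ℤ) = M ^ 2 - 2 - T b + s b + s' b)
    {ε δ : ℤ} (hε : ε = 1 ∨ ε = -1) (hδ : δ = 1 ∨ δ = -1) {k : ℕ}
    (hk : 2 * (k : ℤ) = M ^ 2 - 2 - ε * M + 2 * δ) :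
    4 * (#{b | wt b = k} : ℤ) = M ^ 2 + 2 * ε * δ * M := by
  have key := card_filter_mul_eq_sum (fun b => wt b = k) (8 * M) _ (fun b => by
    -- Weight `k` means T = εM and s = s' = δ; this is the expansion of (M + εT)(1 + δs)(1 + δs').
    show _ = M + (M * δ) * s b + (M * δ) * s' b + M * (s b * s' b) + ε * T b
      + (ε * δ) * (T b * s b) + (ε * δ) * (T b * s' b) + ε * (T b * (s b * s' b))
    have h1 := hwt b
    rcases hT b with h2 | h2 <;> rcases hs b with h3 | h3 <;> rcases hs' b with h4 | h4 <;>
    rcases hε with rfl | rfl <;> rcases hδ with rfl | rfl <;> rw [h2, h3, h4] at h1 ⊢ <;>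
    split_ifs with h5 <;> first | ring1 | (exfalso; subst h5; omega) | (exfalso; apply h5; omega))
  rw [h.sum_eq] at key
  have : 2 * M * (4 * (#{b | wt b = k} : ℤ)) = 2 * M * (M ^ 2 + 2 * ε * δ * M) := by
    linear_combination key
  exact mul_left_cancel₀ (by omega) this

theorem SignMoments.card_bent_distinct (h : SignMoments T s s' (2 * M ^ 2) (2 * M ^ 2))
    (hM : 8 ≤ M) (hT : ∀ b, T b = M ∨ T b = -M) (hs : ∀ b, s b = 1 ∨ s b = -1)
    (hs' : ∀ b, s' b = 1 ∨ s' b = -1)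
    (hwt : ∀ b, 2 * (wt b : ℤ) = M ^ 2 - 2 - T b + s b + s' b)
    {ε : ℤ} (hε : ε = 1 ∨ ε = -1) {k : ℕ} (hk : 2 * (k : ℤ) = M ^ 2 - 2 - ε * M) :
    2 * (#{b | wt b = k} : ℤ) = M ^ 2 := by
  have key := card_filter_mul_eq_sum (fun b => wt b = k) (4 * M) _ (fun b => by
    -- Here the pattern is T = εM, s ≠ s', with indicator (M + εT)(1 - ss') / (4M).
    show _ = M + 0 * s b + 0 * s' b + (-M) * (s b * s' b) + ε * T b
      + 0 * (T b * s b) + 0 * (T b * s' b) + (-ε) * (T b * (s b * s' b))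
    have h1 := hwt b
    rcases hT b with h2 | h2 <;> rcases hs b with h3 | h3 <;> rcases hs' b with h4 | h4 <;>
    rcases hε with rfl | rfl <;> rw [h2, h3, h4] at h1 ⊢ <;>
    split_ifs with h5 <;> first | ring1 | (exfalso; subst h5; omega) | (exfalso; apply h5; omega))
  rw [h.sum_eq] at key
  have : 2 * M * (2 * (#{b | wt b = k} : ℤ)) = 2 * M * (M ^ 2) := by
    linear_combination key
  exact mul_left_cancel₀ (by omega) this

end Counting

theorem card_punctured {K : Type*} [Fintype K] [DecidableEq K] {t t' : K} (ht : t ≠ t') :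
    Fintype.card {x : K // x ∉ ({t, t'} : Finset K)} = Fintype.card K - 2 := by
  rw [Fintype.card_subtype_compl (· ∈ ({t, t'} : Finset K)), Fintype.card_coe, card_pair ht]

theorem weightCount_range {V ι : Type*} [AddCommGroup V] [Module (ZMod 2) V] [Fintype V]
    [Fintype ι] (f : V →ₗ[ZMod 2] (ι → ZMod 2)) (hf : Function.Injective f) (k : ℕ) :
    weightCount (LinearMap.range f) k = #{v | hammingNorm (f v) = k} := by
  have : {c | c ∈ LinearMap.range f ∧ hammingNorm c = k} = f '' {v | hammingNorm (f v) = k} := by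
    ext c
    constructor
    · rintro ⟨⟨v, rfl⟩, h⟩
      exact ⟨v, h, rfl⟩
    · rintro ⟨v, h, rfl⟩
      exact ⟨⟨v, rfl⟩, h⟩
  rw [weightCount, this, Set.ncard_image_of_injective _ hf, Set.ncard_eq_toFinset_card']
  congr 1
  ext
  simp

theorem card_filter_prod_eq_sum {A B : Type*} [Fintype A] [Fintype B] (p : A × B → Prop)
    [DecidablePred p] : #{v | p v} = ∑ a, #{b | p (a, b)} := by
  simp only [card_filter, Fintype.sum_prod_type]

/-! ### Codewords and their moments -/

section Words

variable {K L : Type*} [Field K] [Algebra (ZMod 2) K] [Field L] [Algebra (ZMod 2) L]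

/-- The codeword of `C(F)` with parameters `(a, b, c)`, as a linear function of them. -/
noncomputable def word (F : K → L) : (L × K × ZMod 2) →ₗ[ZMod 2] (K → ZMod 2) where
  toFun p x := Algebra.trace (ZMod 2) L (p.1 * F x) + Algebra.trace (ZMod 2) K (p.2.1 * x) + p.2.2
  map_add' p q := by
    ext x
    simp only [Pi.add_apply, Prod.fst_add, Prod.snd_add, add_mul, map_add]
    ring
  map_smul' r p := by
    ext x
    simp only [Pi.smul_apply, Prod.smul_fst, Prod.smul_snd, smul_eq_mul, smul_mul_assoc, map_smul,
      RingHom.id_apply]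
    ring

theorem word_apply (F : K → L) (a : L) (b : K) (c : ZMod 2) (x : K) :
    word F (a, b, c) x =
      Algebra.trace (ZMod 2) L (a * F x) + Algebra.trace (ZMod 2) K (b * x) + c := rfl

theorem code_eq_range (F : K → L) : code F = LinearMap.range (word F) := by
  ext w
  constructor
  · rintro ⟨a, b, c, rfl⟩
    exact ⟨(a, b, c), rfl⟩
  · rintro ⟨⟨a, b, c⟩, rfl⟩
    exact ⟨a, b, c, rfl⟩

/-- The codeword of the punctured code with parameters `(a, b, c)`. -/
noncomputable def puncturedWord (F : K → L) (P : Finset K) :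
    (L × K × ZMod 2) →ₗ[ZMod 2] ({x : K // x ∉ P} → ZMod 2) :=
  LinearMap.funLeft (ZMod 2) (ZMod 2) Subtype.val ∘ₗ word F

theorem puncture_code_eq_range (F : K → L) (P : Finset K) :
    puncture (code F) P = LinearMap.range (puncturedWord F P) := by
  rw [puncture, code_eq_range, puncturedWord, LinearMap.range_comp]

theorem sgn_word (F : K → L) (a : L) (b : K) (c : ZMod 2) (x : K) :
    sgn (word F (a, b, c) x) = sgn (Algebra.trace (ZMod 2) L (a * F x)) *
      sgn (Algebra.trace (ZMod 2) K (b * x)) * sgn c := by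
  rw [word_apply, sgn_add, sgn_add]

theorem add_eq_zero_iff_eq_of_algebra (x y : K) : x + y = 0 ↔ x = y := by
  have : CharP K 2 := charP_of_injective_algebraMap (algebraMap (ZMod 2) K).injective 2
  rw [add_eq_zero_iff_eq_neg, CharTwo.neg_eq]

theorem sgn_word_zero (F : K → L) (c : ZMod 2) (x : K) : sgn (word F (0, 0, c) x) = sgn c := by
  simp [word_apply]

variable [Fintype K]

theorem sum_sgn_word (F : K → L) (a : L) (b : K) (c : ZMod 2) :
    ∑ x, sgn (word F (a, b, c) x) = walsh F a b * sgn c := by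
  simp only [word_apply, sgn_add _ c, ← sum_mul]
  rfl

theorem exists_trace_mul_eq_one {y : K} (hy : y ≠ 0) :
    ∃ b : K, Algebra.trace (ZMod 2) K (b * y) = 1 := by
  obtain ⟨b, hb⟩ := Algebra.trace_surjective (ZMod 2) K 1
  exact ⟨b * y⁻¹, by rw [mul_assoc, inv_mul_cancel₀ hy, mul_one, hb]⟩

theorem sum_sgn_trace_mul [DecidableEq K] (y : K) :
    ∑ b : K, sgn (Algebra.trace (ZMod 2) K (b * y)) = if y = 0 then (Fintype.card K : ℤ) else 0 := by
  split_ifs with hy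
  · simp [hy, sgn_zero]
  · obtain ⟨b₀, hb₀⟩ := exists_trace_mul_eq_one hy
    -- Translation by `b₀` negates every term, so the sum equals its own negative.
    have h := Equiv.sum_comp (Equiv.addRight b₀)
      (fun b : K => sgn (Algebra.trace (ZMod 2) K (b * y)))
    simp only [Equiv.coe_addRight, add_mul, map_add, hb₀, sgn_add, sgn_one, ← sum_mul] at h
    linarith

theorem sum_sgn_word_mul_sgn_word [DecidableEq K] (F : K → L) (a : L) (x y : K) :
    ∑ q : K × ZMod 2, sgn (word F (a, q) x) * sgn (word F (a, q) y) =
      if x = y then 2 * (Fintype.card K : ℤ) else 0 := by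
  have h (q : K × ZMod 2) : sgn (word F (a, q) x) * sgn (word F (a, q) y) =
      sgn (Algebra.trace (ZMod 2) L (a * F x)) * sgn (Algebra.trace (ZMod 2) L (a * F y)) *
        sgn (Algebra.trace (ZMod 2) K (q.1 * (x + y))) := by
    obtain ⟨b, c⟩ := q
    rw [sgn_word, sgn_word, mul_add, map_add, sgn_add]
    linear_combination (sgn (Algebra.trace (ZMod 2) L (a * F x)) *
      sgn (Algebra.trace (ZMod 2) K (b * x)) * sgn (Algebra.trace (ZMod 2) L (a * F y)) *
      sgn (Algebra.trace (ZMod 2) K (b * y))) * sgn_mul_self c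
  simp only [h, Fintype.sum_prod_type, sum_const, card_univ, ZMod.card, ← smul_sum, ← mul_sum,
    sum_sgn_trace_mul, add_eq_zero_iff_eq_of_algebra]
  split_ifs with hxy
  · rw [hxy, sgn_mul_self]
    simp
  · simp

theorem signMoments_word [DecidableEq K] (F : K → L) (a : L) {t t' : K} (ht : t ≠ t') :
    SignMoments (fun q : K × ZMod 2 => ∑ x, sgn (word F (a, q) x))
      (fun q => sgn (word F (a, q) t)) (fun q => sgn (word F (a, q) t'))
      (2 * Fintype.card K) (2 * Fintype.card K) where
  card := by simp [mul_comm]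
  left := sum_mul_sgn_eq_zero _ fun b c => sgn_word F a b c t
  right := sum_mul_sgn_eq_zero _ fun b c => sgn_word F a b c t'
  both := by rw [sum_sgn_word_mul_sgn_word, if_neg ht]
  total := sum_mul_sgn_eq_zero _ fun b c => sum_sgn_word F a b c
  total_left := by
    simp only [sum_mul]
    rw [sum_comm]
    simp [sum_sgn_word_mul_sgn_word]
  total_right := by
    simp only [sum_mul]
    rw [sum_comm]
    simp [sum_sgn_word_mul_sgn_word]
  total_both := by
    -- The three factors contribute the cube of `sgn c`, which is `sgn c` again.
    refine sum_mul_sgn_eq_zero (fun b => walsh F a b *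
      (sgn (word F (a, b, 0) t) * sgn (word F (a, b, 0) t'))) fun b c => ?_
    simp only [sum_sgn_word]
    simp only [sgn_word, sgn_zero]
    rcases sgn_eq_or c with h | h <;> rw [h] <;> ring

theorem two_mul_hammingNorm_puncturedWord [DecidableEq K] (F : K → L) {t t' : K} (ht : t ≠ t')
    (p : L × K × ZMod 2) :
    2 * (hammingNorm (puncturedWord F {t, t'} p) : ℤ) = Fintype.card K - 2
      - ∑ x, sgn (word F p x) + sgn (word F p t) + sgn (word F p t') := by
  have h := sum_sgn_eq_card_sub (puncturedWord F {t, t'} p)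
  have h1 : ∑ i, sgn (puncturedWord F {t, t'} p i) =
      ∑ x ∈ univ \ {t, t'}, sgn (word F p x) :=
    (sum_subtype (univ \ {t, t'}) (by simp) (fun x => sgn (word F p x))).symm
  have h2 := sum_sdiff (subset_univ ({t, t'} : Finset K)) (f := fun x => sgn (word F p x))
  rw [sum_pair ht] at h2
  have h3 : 2 ≤ Fintype.card K := by
    rw [← card_pair ht]; exact card_le_univ _
  rw [h1, card_punctured ht, Nat.cast_sub h3] at h
  push_cast at h
  linarith

/-! ### The affine words, a = 0 -/

theorem walsh_zero_left [DecidableEq K] (F : K → L) (b : K) :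
    walsh F 0 b = if b = 0 then (Fintype.card K : ℤ) else 0 := by
  rw [← sum_sgn_trace_mul]
  simp [walsh, sgn, mul_comm]

theorem hammingNorm_puncturedWord_zero_left [DecidableEq K] (F : K → L) {t t' : K} (ht : t ≠ t')
    (b : K) (c : ZMod 2) :
    (b = 0 ∧ 2 * (hammingNorm (puncturedWord F {t, t'} (0, b, c)) : ℤ) =
      (Fintype.card K - 2) * (1 - sgn c)) ∨
    (b ≠ 0 ∧ 2 * (hammingNorm (puncturedWord F {t, t'} (0, b, c)) : ℤ) =
      Fintype.card K - 2 + sgn (word F (0, b, c) t) + sgn (word F (0, b, c) t')) := by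
  rw [two_mul_hammingNorm_puncturedWord F ht, sum_sgn_word, walsh_zero_left]
  by_cases hb : b = 0
  · subst hb
    rw [sgn_word_zero, sgn_word_zero, if_pos rfl]
    exact Or.inl ⟨rfl, by ring⟩
  · rw [if_neg hb]
    exact Or.inr ⟨hb, by ring⟩

/-- The bound on |K| excludes |K| = 4, where the weights 0 and |K| - 2 would collide with those
counted here. -/
theorem card_linear_equal [DecidableEq K] (F : K → L) {t t' : K} (ht : t ≠ t')
    (hK : 5 ≤ Fintype.card K) {δ : ℤ} (hδ : δ = 1 ∨ δ = -1) {k : ℕ}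
    (hk : 2 * (k : ℤ) = Fintype.card K - 2 + 2 * δ) :
    2 * (#{q | hammingNorm (puncturedWord F {t, t'} (0, q)) = k} : ℤ) = Fintype.card K - 2 := by
  have key := card_filter_mul_eq_sum
    (fun q => hammingNorm (puncturedWord F {t, t'} (0, q)) = k) 4 _ (fun q => by
    show _ = (1 + δ * sgn (word F (0, q) t) + δ * sgn (word F (0, q) t') +
      1 * (sgn (word F (0, q) t) * sgn (word F (0, q) t')) + 0 * (∑ x, sgn (word F (0, q) x))
      + 0 * ((∑ x, sgn (word F (0, q) x)) * sgn (word F (0, q) t))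
      + 0 * ((∑ x, sgn (word F (0, q) x)) * sgn (word F (0, q) t'))
      + 0 * ((∑ x, sgn (word F (0, q) x)) * (sgn (word F (0, q) t) * sgn (word F (0, q) t'))))
      -- At b = 0 both signs equal `sgn c`, so (1 + δs)(1 + δs') = 2(1 + δ `sgn c`) must be removed.
      - (if q.1 = 0 then 2 else 0) * (1 + δ * sgn q.2)
    obtain ⟨b, c⟩ := q
    simp only [zero_mul, add_zero]
    rcases hammingNorm_puncturedWord_zero_left F ht b c with ⟨hb, h⟩ | ⟨hb, h⟩
    · subst hb
      rw [sgn_word_zero, sgn_word_zero, if_pos rfl, if_neg (by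
        intro h5
        subst h5
        rcases sgn_eq_or c with h1 | h1 <;> rw [h1] at h <;> omega)]
      rcases sgn_eq_or c with h1 | h1 <;> rcases hδ with rfl | rfl <;> rw [h1] <;> ring1
    · rw [if_neg hb]
      rcases sgn_eq_or (word F (0, b, c) t) with h1 | h1 <;>
      rcases sgn_eq_or (word F (0, b, c) t') with h2 | h2 <;>
      rcases hδ with rfl | rfl <;> rw [h1, h2] at h ⊢ <;> split_ifs with h5 <;>
      first | ring1 | (exfalso; subst h5; omega) | (exfalso; apply h5; omega))
  rw [sum_sub_distrib, (signMoments_word F 0 ht).sum_eq, Fintype.sum_prod_type] at key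
  simp only [ite_mul, zero_mul, sum_ite_irrel, sum_const_zero, sum_ite_eq', mem_univ, if_true,
    ← mul_sum, sum_add_distrib, sum_sgn, sum_const, card_univ, ZMod.card, nsmul_eq_mul] at key
  push_cast at key
  linarith

theorem card_linear_distinct [DecidableEq K] (F : K → L) {t t' : K} (ht : t ≠ t')
    (hK : 5 ≤ Fintype.card K) {k : ℕ} (hk : 2 * (k : ℤ) = Fintype.card K - 2) :
    (#{q | hammingNorm (puncturedWord F {t, t'} (0, q)) = k} : ℤ) = Fintype.card K := by
  have key := card_filter_mul_eq_sum
    (fun q => hammingNorm (puncturedWord F {t, t'} (0, q)) = k) 2 _ (fun q => by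
    show _ = 1 + 0 * sgn (word F (0, q) t) + 0 * sgn (word F (0, q) t') +
      -- No correction is needed: 1 - ss' already vanishes at b = 0.
      (-1) * (sgn (word F (0, q) t) * sgn (word F (0, q) t')) + 0 * (∑ x, sgn (word F (0, q) x))
      + 0 * ((∑ x, sgn (word F (0, q) x)) * sgn (word F (0, q) t))
      + 0 * ((∑ x, sgn (word F (0, q) x)) * sgn (word F (0, q) t'))
      + 0 * ((∑ x, sgn (word F (0, q) x)) * (sgn (word F (0, q) t) * sgn (word F (0, q) t')))
    obtain ⟨b, c⟩ := q
    simp only [zero_mul, add_zero]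
    rcases hammingNorm_puncturedWord_zero_left F ht b c with ⟨hb, h⟩ | ⟨hb, h⟩
    · subst hb
      rw [sgn_word_zero, sgn_word_zero, sgn_mul_self, if_neg (by
        intro h5
        subst h5
        rcases sgn_eq_or c with h1 | h1 <;> rw [h1] at h <;> omega)]
      ring
    · rcases sgn_eq_or (word F (0, b, c) t) with h1 | h1 <;>
      rcases sgn_eq_or (word F (0, b, c) t') with h2 | h2 <;>
      rw [h1, h2] at h ⊢ <;> split_ifs with h5 <;>
      first | ring1 | (exfalso; subst h5; omega) | (exfalso; apply h5; omega))
  rw [(signMoments_word F 0 ht).sum_eq] at key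
  linarith

theorem hammingNorm_puncturedWord_zero_left_eq_iff [DecidableEq K] (F : K → L) {t t' : K}
    (ht : t ≠ t') (hK : 5 ≤ Fintype.card K) (b : K) (c : ZMod 2) :
    hammingNorm (puncturedWord F {t, t'} (0, b, c)) = Fintype.card K - 2 ↔ b = 0 ∧ c = 1 := by
  have hc : (c = 0 ∧ sgn c = 1) ∨ (c = 1 ∧ sgn c = -1) := by revert c; decide
  rcases hammingNorm_puncturedWord_zero_left F ht b c with ⟨hb, h⟩ | ⟨hb, h⟩
  · rcases hc with ⟨rfl, h1⟩ | ⟨rfl, h1⟩ <;> rw [h1] at h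
    · exact iff_of_false (by omega) (by simp)
    · exact iff_of_true (by omega) ⟨hb, rfl⟩
  · refine iff_of_false ?_ (by simp [hb])
    rcases sgn_eq_or (word F (0, b, c) t) with h1 | h1 <;>
    rcases sgn_eq_or (word F (0, b, c) t') with h2 | h2 <;> rw [h1, h2] at h <;> omega

theorem eq_zero_of_hammingNorm_puncturedWord_zero_left [DecidableEq K] (F : K → L) {t t' : K}
    (ht : t ≠ t') (hK : 5 ≤ Fintype.card K) (b : K) (c : ZMod 2)
    (h0 : hammingNorm (puncturedWord F {t, t'} (0, b, c)) = 0) : b = 0 ∧ c = 0 := by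
  have hc : (c = 0 ∧ sgn c = 1) ∨ (c = 1 ∧ sgn c = -1) := by
    clear h0; revert c; decide
  rcases hammingNorm_puncturedWord_zero_left F ht b c with ⟨hb, h⟩ | ⟨hb, h⟩
  · rcases hc with ⟨rfl, h1⟩ | ⟨rfl, h1⟩ <;> rw [h1] at h
    · exact ⟨hb, rfl⟩
    · omega
  · rcases sgn_eq_or (word F (0, b, c) t) with h1 | h1 <;>
    rcases sgn_eq_or (word F (0, b, c) t') with h2 | h2 <;> rw [h1, h2] at h <;> omega

/-! ### Bent components and injectivity -/

theorem finrank_eq_of_card {V : Type*} [AddCommGroup V] [Module (ZMod 2) V] [Fintype V] {n : ℕ}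
    (hV : Fintype.card V = 2 ^ n) : Module.finrank (ZMod 2) V = n := by
  rw [Module.card_eq_pow_finrank (K := ZMod 2), ZMod.card] at hV
  exact Nat.pow_right_injective le_rfl hV

theorem IsBentVectorial.walsh_eq_or {F : K → L} (hF : IsBentVectorial F) {m : ℕ}
    (hK : Fintype.card K = 2 ^ (2 * m)) {a : L} (ha : a ≠ 0) (b : K) :
    walsh F a b = 2 ^ m ∨ walsh F a b = -2 ^ m := by
  have h := hF a ha b
  have h2 : (((2 * m : ℕ) : ℝ)) / 2 = m := by push_cast; ring
  rw [finrank_eq_of_card hK, h2, Real.rpow_natCast] at h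
  exact_mod_cast h

theorem IsBentVectorial.sum_sgn_word_eq_or {F : K → L} (hF : IsBentVectorial F) {m : ℕ}
    (hK : Fintype.card K = 2 ^ (2 * m)) {a : L} (ha : a ≠ 0) (q : K × ZMod 2) :
    ∑ x, sgn (word F (a, q) x) = 2 ^ m ∨ ∑ x, sgn (word F (a, q) x) = -2 ^ m := by
  obtain ⟨b, c⟩ := q
  rw [sum_sgn_word]
  rcases hF.walsh_eq_or hK ha b with h | h <;> rcases sgn_eq_or c with h1 | h1 <;>
    simp [h, h1]

theorem weightCount_puncture_code [DecidableEq K] [Fintype L] (F : K → L) (P : Finset K)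
    (hinj : Function.Injective (puncturedWord F P)) {k N₀ N₁ : ℕ}
    (h₀ : #{q | hammingNorm (puncturedWord F P (0, q)) = k} = N₀)
    (h₁ : ∀ a : L, a ≠ 0 → #{q | hammingNorm (puncturedWord F P (a, q)) = k} = N₁) :
    weightCount (puncture (code F) P) k = N₀ + (Fintype.card L - 1) * N₁ := by
  classical
  rw [puncture_code_eq_range, weightCount_range _ hinj, card_filter_prod_eq_sum,
    ← add_sum_erase univ _ (mem_univ (0 : L)), h₀,
    sum_congr rfl fun a ha => h₁ a (ne_of_mem_erase ha)]
  simp [card_erase_of_mem]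

theorem injective_puncturedWord [DecidableEq K] {F : K → L} (hF : IsBentVectorial F) {m : ℕ}
    (hm : 3 ≤ m) (hK : Fintype.card K = 2 ^ (2 * m)) {t t' : K} (ht : t ≠ t') :
    Function.Injective (puncturedWord F {t, t'}) := by
  rw [injective_iff_map_eq_zero]
  rintro ⟨a, b, c⟩ h
  have hM : 8 ≤ (2 : ℤ) ^ m := by
    calc (8 : ℤ) = 2 ^ 3 := by norm_num
      _ ≤ 2 ^ m := pow_le_pow_right₀ (by norm_num) hm
  have hcard : (Fintype.card K : ℤ) = (2 ^ m) ^ 2 := by rw [hK, ← pow_mul, mul_comm]; norm_num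
  have h0 : hammingNorm (puncturedWord F {t, t'} (a, b, c)) = 0 := by rw [h, hammingNorm_zero]
  by_cases ha : a = 0
  · subst ha
    obtain ⟨rfl, rfl⟩ := eq_zero_of_hammingNorm_puncturedWord_zero_left F ht
      (by zify; nlinarith) b c h0
    rfl
  · exfalso
    have h1 := two_mul_hammingNorm_puncturedWord F ht (a, b, c)
    rw [h0, hcard] at h1
    rcases hF.sum_sgn_word_eq_or hK ha (b, c) with h2 | h2 <;>
    rcases sgn_eq_or (word F (a, b, c) t) with h3 | h3 <;>
    rcases sgn_eq_or (word F (a, b, c) t') with h4 | h4 <;>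
    rw [h2, h3, h4] at h1 <;> push_cast at h1 <;> nlinarith

end Words

end PuncturedBentCode

/-! ### Assembling the weight distribution -/

open PuncturedBentCode Finset in
theorem mainTheorem12 {K L : Type*}
    [Field K] [Fintype K] [DecidableEq K] [Algebra (ZMod 2) K]
    [Field L] [Fintype L] [Algebra (ZMod 2) L]
    (m ℓ : ℕ) (hm : 3 ≤ m)
    (hK : Fintype.card K = 2 ^ (2 * m)) (hL : Fintype.card L = 2 ^ ℓ)
    (F : K → L) (hF : PuncturedBentCode.IsBentVectorial F)
    (t₁ t₂ : K) (ht : t₁ ≠ t₂)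
    (C : Submodule (ZMod 2) ({x : K // x ∉ ({t₁, t₂} : Finset K)} → ZMod 2))
    (hC : C = PuncturedBentCode.puncture (PuncturedBentCode.code F) {t₁, t₂}) :
    -- length and dimension
    Fintype.card {x : K // x ∉ ({t₁, t₂} : Finset K)} = 2 ^ (2 * m) - 2 ∧
    Module.finrank (ZMod 2) C = 2 * m + ℓ + 1 ∧
    -- weight distribution
    PuncturedBentCode.weightCount C 0 = 1 ∧
    PuncturedBentCode.weightCount C (2 ^ (2 * m - 1) - 2 ^ (m - 1) - 2) =
      2 ^ (m - 2) * (2 ^ ℓ - 1) * (2 ^ m - 2) ∧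
    PuncturedBentCode.weightCount C (2 ^ (2 * m - 1) - 2 ^ (m - 1) - 1) =
      2 ^ (2 * m - 1) * (2 ^ ℓ - 1) ∧
    PuncturedBentCode.weightCount C (2 ^ (2 * m - 1) - 2 ^ (m - 1)) =
      (2 ^ ℓ - 1) * 2 ^ (m - 2) * (2 ^ m + 2) ∧
    PuncturedBentCode.weightCount C (2 ^ (2 * m - 1) - 2) = 2 ^ (2 * m - 1) - 1 ∧
    PuncturedBentCode.weightCount C (2 ^ (2 * m - 1) - 1) = 2 ^ (2 * m) ∧
    PuncturedBentCode.weightCount C (2 ^ (2 * m - 1)) = 2 ^ (2 * m - 1) - 1 ∧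
    PuncturedBentCode.weightCount C (2 ^ (2 * m - 1) + 2 ^ (m - 1) - 2) =
      2 ^ (m - 2) * (2 ^ ℓ - 1) * (2 ^ m + 2) ∧
    PuncturedBentCode.weightCount C (2 ^ (2 * m - 1) + 2 ^ (m - 1) - 1) =
      2 ^ (2 * m - 1) * (2 ^ ℓ - 1) ∧
    PuncturedBentCode.weightCount C (2 ^ (2 * m - 1) + 2 ^ (m - 1)) =
      (2 ^ ℓ - 1) * 2 ^ (m - 2) * (2 ^ m - 2) ∧
    PuncturedBentCode.weightCount C (2 ^ (2 * m) - 2) = 1 ∧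
    (∀ k : ℕ, k ∉ ({0,
        2 ^ (2 * m - 1) - 2 ^ (m - 1) - 2,
        2 ^ (2 * m - 1) - 2 ^ (m - 1) - 1,
        2 ^ (2 * m - 1) - 2 ^ (m - 1),
        2 ^ (2 * m - 1) - 2,
        2 ^ (2 * m - 1) - 1,
        2 ^ (2 * m - 1),
        2 ^ (2 * m - 1) + 2 ^ (m - 1) - 2,
        2 ^ (2 * m - 1) + 2 ^ (m - 1) - 1,
        2 ^ (2 * m - 1) + 2 ^ (m - 1),
        2 ^ (2 * m) - 2} : Set ℕ) →
      PuncturedBentCode.weightCount C k = 0) := by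
  subst hC
  obtain ⟨Q, hQ⟩ : ∃ Q : ℕ, Q = 2 ^ (m - 2) := ⟨_, rfl⟩
  -- This separates the bent weights 8Q² ± 2Q - j from the affine weights 8Q² - j (j = 0, 1, 2); at
  -- Q = 1 they overlap.
  have hQ2 : 2 ≤ Q := by
    rw [hQ]
    calc 2 = 2 ^ 1 := rfl
      _ ≤ 2 ^ (m - 2) := Nat.pow_le_pow_right (by norm_num) (by omega)
  have hm0 : 2 ^ m = 4 * Q := by
    rw [hQ, show m = (m - 2) + 2 by omega, pow_add]
    simp; ring
  have hm1 : 2 ^ (m - 1) = 2 * Q := by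
    rw [hQ, show m - 1 = (m - 2) + 1 by omega, pow_succ, mul_comm]
  have hm2 : 2 ^ (2 * m - 1) = 8 * (Q * Q) := by
    rw [hQ, show 2 * m - 1 = (m - 2) + (m - 2) + 3 by omega, pow_add, pow_add, mul_comm]; norm_num
  have hm3 : 2 ^ (2 * m) = 16 * (Q * Q) := by
    rw [hQ, show 2 * m = (m - 2) + (m - 2) + 4 by omega, pow_add, pow_add, mul_comm]
    congr 3
  have hMQ : (2 : ℤ) ^ m = 4 * Q := by exact_mod_cast hm0
  have hQQ : 2 * Q ≤ Q * Q := Nat.mul_le_mul_right Q hQ2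
  have hinj := injective_puncturedWord hF hm hK ht
  have hlength := card_punctured ht
  have hcard : Fintype.card K = 16 * (Q * Q) := by rw [hK, hm3]
  have hT (a : L) (ha : a ≠ 0) := hF.sum_sgn_word_eq_or hK ha
  have hwt (p : L × K × ZMod 2) := two_mul_hammingNorm_puncturedWord F ht p
  have hmom (a : L) := signMoments_word F a ht
  have hs (x : K) (a : L) (q : K × ZMod 2) := sgn_eq_or (word F (a, q) x)
  simp only [hMQ] at hT
  have hcard' : (Fintype.card K : ℤ) = (4 * Q) ^ 2 := by rw [hcard]; push_cast; ring
  rw [hcard'] at hmom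
  simp only [hcard'] at hwt
  have hEq (a : L) (ha : a ≠ 0) {ε δ : ℤ} (hε : ε = 1 ∨ ε = -1) (hδ : δ = 1 ∨ δ = -1) {k : ℕ} :=
    (hmom a).card_bent_equal (k := k) (by omega) (hT a ha) (hs t₁ a) (hs t₂ a)
      (fun q => hwt (a, q)) hε hδ
  have hNe (a : L) (ha : a ≠ 0) {ε : ℤ} (hε : ε = 1 ∨ ε = -1) {k : ℕ} :=
    (hmom a).card_bent_distinct (k := k) (by omega) (hT a ha) (hs t₁ a) (hs t₂ a)
      (fun q => hwt (a, q)) hε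
  have hsq : ((4 * Q : ℤ)) ^ 2 = 16 * ((Q * Q : ℕ) : ℤ) := by push_cast; ring
  simp only [hsq] at hwt hEq hNe
  have hbent0 {k : ℕ} (hk : ∀ ε ∈ ({1, -1} : Finset ℤ), ∀ j ∈ ({0, 1, 2} : Finset ℤ),
      (k : ℤ) ≠ 8 * ((Q * Q : ℕ) : ℤ) - ε * (2 * Q) - j) (a : L) (ha : a ≠ 0) :
      #{q | hammingNorm (puncturedWord F {t₁, t₂} (a, q)) = k} = 0 := by
    simp only [mem_insert, mem_singleton, forall_eq_or_imp, forall_eq] at hk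
    rw [card_eq_zero, filter_eq_empty_iff]
    intro q _ hq
    have h1 := hwt (a, q)
    rcases hT a ha q with h2 | h2 <;> rcases hs t₁ a q with h3 | h3 <;>
    rcases hs t₂ a q with h4 | h4 <;> rw [h2, h3, h4] at h1 <;> omega
  have hlin0 {k : ℕ} (hk : k ≠ 0) (hk' : k ≠ 16 * (Q * Q) - 2)
      (hk'' : ∀ j ∈ ({0, 1, 2} : Finset ℤ), (k : ℤ) ≠ 8 * ((Q * Q : ℕ) : ℤ) - j) :
      #{q | hammingNorm (puncturedWord F {t₁, t₂} (0, q)) = k} = 0 := by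
    simp only [mem_insert, mem_singleton, forall_eq_or_imp, forall_eq] at hk''
    rw [card_eq_zero, filter_eq_empty_iff]
    rintro ⟨b, c⟩ _ hq
    rcases hammingNorm_puncturedWord_zero_left F ht b c with ⟨hb, h⟩ | ⟨hb, h⟩ <;>
      rw [hcard', hsq] at h
    · rcases sgn_eq_or c with h1 | h1 <;> rw [h1] at h <;> omega
    · rcases hs t₁ 0 (b, c) with h3 | h3 <;> rcases hs t₂ 0 (b, c) with h4 | h4 <;>
        rw [h3, h4] at h <;> omega
  have hC (k N₀ N₁ : ℕ) := weightCount_puncture_code F {t₁, t₂} hinj (k := k) (N₀ := N₀) (N₁ := N₁)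
  rw [hL] at hC
  rw [hm0, hm1, hm2, hm3, ← hQ]
  generalize 2 ^ ℓ - 1 = D at hC ⊢
  -- With Q² as an atom, the remaining comparisons of weights and counts are linear in `A` and `Q`.
  obtain ⟨A, hA⟩ : ∃ A, A = Q * Q := ⟨_, rfl⟩
  have hsub : Q * (4 * Q - 2) = 4 * A - 2 * Q := by
    rw [Nat.mul_sub, hA]; congr 1 <;> ring
  have hadd : Q * (4 * Q + 2) = 4 * A + 2 * Q := by rw [hA]; ring
  rw [mul_right_comm Q D, hsub, mul_right_comm Q D, hadd, mul_assoc D, hadd, mul_assoc D, hsub]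
  rw [← hA] at hcard hlin0 hbent0 hEq hNe hsq hQQ ⊢
  have one_eq : (1 : ℤ) = 1 ∨ (1 : ℤ) = -1 := Or.inl rfl
  have neg_one_eq : (-1 : ℤ) = 1 ∨ (-1 : ℤ) = -1 := Or.inr rfl
  have hcardA : (Fintype.card K : ℤ) = 16 * A := by rw [hcard]; norm_num
  have hbent {k N : ℕ} (hk : k ≠ 0) (hk' : k ≠ 16 * A - 2)
      (hk'' : ∀ j ∈ ({0, 1, 2} : Finset ℤ), (k : ℤ) ≠ 8 * (A : ℤ) - j)
      (h : ∀ a : L, a ≠ 0 → #{q | hammingNorm (puncturedWord F {t₁, t₂} (a, q)) = k} = N) :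
      weightCount (puncture (code F) {t₁, t₂}) k = D * N := by
    rw [hC k 0 N (hlin0 hk hk' hk'') h, zero_add]
  have hlin {k N : ℕ} (hk : ∀ ε ∈ ({1, -1} : Finset ℤ), ∀ j ∈ ({0, 1, 2} : Finset ℤ),
      (k : ℤ) ≠ 8 * (A : ℤ) - ε * (2 * Q) - j)
      (h : #{q | hammingNorm (puncturedWord F {t₁, t₂} ((0 : L), q)) = k} = N) :
      weightCount (puncture (code F) {t₁, t₂}) k = N := by
    rw [hC k N 0 h (hbent0 hk), mul_zero, add_zero]
  simp only [mem_insert, mem_singleton, forall_eq_or_imp, forall_eq] at hbent hlin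
  refine ⟨by rw [hlength, hcard], ?_, ?_, ?_, ?_, ?_, ?_, ?_, ?_, ?_, ?_, ?_, ?_, ?_⟩
  · rw [puncture_code_eq_range, LinearMap.finrank_range_of_inj hinj, Module.finrank_prod,
      Module.finrank_prod, finrank_eq_of_card hK, finrank_eq_of_card hL, Module.finrank_self]
    ring
  · refine hlin (by omega) ?_
    rw [card_eq_one]
    refine ⟨(0, 0), ?_⟩
    ext ⟨b, c⟩
    simp only [mem_filter, mem_univ, true_and, mem_singleton, Prod.mk.injEq]
    refine ⟨eq_zero_of_hammingNorm_puncturedWord_zero_left F ht (by omega) b c, ?_⟩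
    rintro ⟨rfl, rfl⟩
    rw [hammingNorm_eq_zero]
    exact map_zero (puncturedWord F {t₁, t₂})
  · rw [mul_comm _ D]
    refine hbent (by omega) (by omega) (by omega) fun a ha => ?_
    have := hEq a ha one_eq neg_one_eq (k := 8 * A - 2 * Q - 2) (by omega)
    omega
  · rw [mul_comm _ D]
    refine hbent (by omega) (by omega) (by omega) fun a ha => ?_
    have := hNe a ha one_eq (k := 8 * A - 2 * Q - 1) (by omega)
    omega
  · refine hbent (by omega) (by omega) (by omega) fun a ha => ?_
    have := hEq a ha one_eq one_eq (k := 8 * A - 2 * Q) (by omega)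
    omega
  · refine hlin (by omega) ?_
    have := card_linear_equal F ht (by omega) neg_one_eq (k := 8 * A - 2) (by omega)
    omega
  · refine hlin (by omega) ?_
    have := card_linear_distinct F ht (by omega) (k := 8 * A - 1) (by omega)
    omega
  · refine hlin (by omega) ?_
    have := card_linear_equal F ht (by omega) one_eq (k := 8 * A) (by omega)
    omega
  · rw [mul_comm _ D]
    refine hbent (by omega) (by omega) (by omega) fun a ha => ?_
    have := hEq a ha neg_one_eq neg_one_eq (k := 8 * A + 2 * Q - 2) (by omega)
    omega
  · rw [mul_comm _ D]
    refine hbent (by omega) (by omega) (by omega) fun a ha => ?_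
    have := hNe a ha neg_one_eq (k := 8 * A + 2 * Q - 1) (by omega)
    omega
  · refine hbent (by omega) (by omega) (by omega) fun a ha => ?_
    have := hEq a ha neg_one_eq one_eq (k := 8 * A + 2 * Q) (by omega)
    omega
  · refine hlin (by omega) ?_
    rw [card_eq_one]
    refine ⟨(0, 1), ?_⟩
    ext ⟨b, c⟩
    simp only [mem_filter, mem_univ, true_and, mem_singleton, Prod.mk.injEq]
    rw [← hcard]
    exact hammingNorm_puncturedWord_zero_left_eq_iff F ht (by omega) b c
  · intro k hk
    simp only [Set.mem_insert_iff, Set.mem_singleton_iff, not_or] at hk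
    rw [hlin (N := 0) (by omega) (hlin0 (by omega) (by omega) (by simp; omega))]
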